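/- Let $F/\mathbb F_q$ be an algebraic function field of one variable (that is, $F$ is a finite extension of $\mathbb F_q(x)$ for some $x\in F$ transcendental over $\mathbb F_q$) whose full constant field is $\mathbb F_q$. Let $P_1,\dots,P_n$ be pairwise distinct places of $F/\mathbb F_q$ of degree one, put $D=P_1+\cdots+P_n$, and let $G$ be a divisor of $F/\mathbb F_q$ with $\operatorname{supp} G\cap\operatorname{supp} D=\emptyset$. For a divisor $A$ let $L(A)=\{x\in F^{*} : (x)\ge -A\}\cup\{0\}$. Let $$C(D,G)=\{(x(P_1),\dots,x(P_n)) : x\in L(G)\}\subseteq\mathbb F_q^{\,n},$$ where $x(P_i)$ is the residue class of $x$ in the residue class field $\mathbb F_q$ of $P_i$. Then $L(G)$ and $L(G-D)$ are finite-dimensional over $\mathbb F_q$, and $C(D,G)$ is a linear code of length $n$ and dimension $$k=\dim_{\mathbb F_q} L(G)-\dim_{\mathbb F_q} L(G-D).$$ If moreover $C(D,G)\neq\{0\}$, then its minimum distance $d$ (the least Hamming distance between two different codewords) satisfies $$d\ge n-\deg G.$$ -/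

import Mathlib

/-- `F / K` is an algebraic function field of one variable: `F` is a finite extension of `K(x)`
for some `x ∈ F` that is transcendental over `K`. -/
class IsAlgFunctionField (K F : Type*) [Field K] [Field F] [Algebra K F] : Prop where
  exists_transcendental : ∃ x : F, Transcendental K x ∧
    FiniteDimensional (IntermediateField.adjoin K ({x} : Set F)) F

/-- A place of `F / K`, given by its valuation ring `𝒪` with `K ⊊ 𝒪 ⊊ F`; the place itself is the
maximal ideal of `𝒪`, and either of the two determines the other. -/
@[ext]
structure Place (K F : Type*) [Field K] [Field F] [Algebra K F] where
  /-- The valuation ring of the place. -/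
  ring : ValuationSubring F
  range_lt : (algebraMap K F).range < ring.toSubring
  ring_ne_top : ring ≠ ⊤

namespace Place

open Polynomial
open scoped IntermediateField.algebraAdjoinAdjoin

variable {K F : Type*} [Field K] [Field F] [Algebra K F]

theorem algebraMap_mem (P : Place K F) (a : K) : algebraMap K F a ∈ P.ring :=
  P.range_lt.le ⟨a, rfl⟩

instance (P : Place K F) : Algebra K P.ring :=
  ((algebraMap K F).codRestrict P.ring.toSubring P.algebraMap_mem).toAlgebra

theorem coe_algebraMap (P : Place K F) (a : K) :
    ((algebraMap K P.ring a : P.ring) : F) = algebraMap K F a := rfl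

theorem coe_smul (P : Place K F) (a : K) (z : P.ring) :
    ((a • z : P.ring) : F) = a • (z : F) := by
  rw [Algebra.smul_def, Algebra.smul_def]; rfl

instance (P : Place K F) : IsScalarTower K P.ring F :=
  IsScalarTower.of_algebraMap_eq fun _ => rfl

/-- The residue class field `𝒪_P / P`. -/
abbrev residueField (P : Place K F) : Type _ := IsLocalRing.ResidueField P.ring

/-- The degree of a place: the degree over `K` of its residue class field. -/
noncomputable def degree (P : Place K F) : ℕ := Module.finrank K P.residueField

open Classical in
/-- The residue class map `x ↦ x(P)`, from `F` to the residue class field together with a point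
`∞` (here `⊤`), which is the value at the elements outside the valuation ring. -/
noncomputable def value (P : Place K F) (x : F) : WithTop P.residueField :=
  if h : x ∈ P.ring then ((IsLocalRing.residue P.ring ⟨x, h⟩ : P.residueField) : WithTop _) else ⊤

/-! ### The valuation ring of a place of a function field is a discrete valuation ring -/

/-- A nonzero element of the maximal ideal is transcendental over `K`. -/
theorem transcendental_of_mem (P : Place K F) {y : P.ring} (hy0 : y ≠ 0)
    (hy : y ∈ IsLocalRing.maximalIdeal P.ring) : Transcendental K (y : F) := by
  intro halg
  have hinv : (y : F)⁻¹ ∈ P.ring := by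
    have h1 : (y : F)⁻¹ ∈ Algebra.adjoin K ({(y : F)} : Set F) := by
      have h2 := (IntermediateField.adjoin K ({(y : F)} : Set F)).inv_mem
        (IntermediateField.mem_adjoin_simple_self K (y : F))
      rwa [← IntermediateField.mem_toSubalgebra,
        IntermediateField.adjoin_simple_toSubalgebra_of_isAlgebraic halg] at h2
    refine Algebra.adjoin_induction (p := fun x _ => x ∈ P.ring) (fun x hx => ?_)
      P.algebraMap_mem (fun _ _ _ _ => P.ring.add_mem _ _) (fun _ _ _ _ => P.ring.mul_mem _ _) h1
    rw [Set.mem_singleton_iff.mp hx]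
    exact y.2
  refine (IsLocalRing.mem_maximalIdeal y).mp hy ?_
  refine IsUnit.of_mul_eq_one (⟨(y : F)⁻¹, hinv⟩ : P.ring) (Subtype.ext ?_)
  exact mul_inv_cancel₀ fun h => hy0 (Subtype.ext h)

/-- If `y` is a transcendental element of a function field then `F` is finite over `K(y)`. -/
theorem finite_adjoin_of_transcendental [h : IsAlgFunctionField K F] {y : F}
    (hy : Transcendental K y) :
    FiniteDimensional (IntermediateField.adjoin K ({y} : Set F)) F := by
  obtain ⟨x, hx, hfin⟩ := h.exists_transcendental
  have hess : Algebra.EssFiniteType K F :=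
    have : Algebra.EssFiniteType K (IntermediateField.adjoin K ({x} : Set F)) :=
      IntermediateField.essFiniteType_iff.mpr ⟨{x}, by simp⟩
    .comp K (IntermediateField.adjoin K ({x} : Set F)) F
  have hx' : IsTranscendenceBasis K ((↑) : ({x} : Set F) → F) := by
    refine isTranscendenceBasis_iff_algebraicIndependent_isAlgebraic.mpr ⟨?_, ?_⟩
    · exact algebraicIndependent_unique_type_iff.mpr hx
    · rw [Subtype.range_coe]
      have : Algebra.IsAlgebraic (IntermediateField.adjoin K ({x} : Set F)) F := inferInstance
      exact (IsFractionRing.comap_isAlgebraic_iff (A := Algebra.adjoin K ({x} : Set F))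
        (K := IntermediateField.adjoin K ({x} : Set F)) (C := F)).mpr this
  have hy' : IsTranscendenceBasis K ((↑) : ({y} : Set F) → F) := by
    refine AlgebraicIndependent.isTranscendenceBasis_of_trdeg_le_of_finite
      (algebraicIndependent_unique_type_iff.mpr hy) ?_
    rw [← hx'.cardinalMk_eq_trdeg]
    simp
  have hA := hy'.isAlgebraic
  rw [Subtype.range_coe] at hA
  have : Algebra.IsAlgebraic (IntermediateField.adjoin K ({y} : Set F)) F :=
    (IsFractionRing.comap_isAlgebraic_iff (A := Algebra.adjoin K ({y} : Set F))
        (K := IntermediateField.adjoin K ({y} : Set F)) (C := F)).mp hA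
  have : Algebra.EssFiniteType (IntermediateField.adjoin K ({y} : Set F)) F :=
    .of_comp K _ F
  exact Algebra.finite_of_essFiniteType_of_isAlgebraic

/-- Elements of the valuation ring that are linearly independent over `K` modulo `y` are linearly
independent over `K[y]`. -/
theorem eq_zero_of_sum_aeval (P : Place K F) {y : P.ring} (hy0 : y ≠ 0) {ι : Type*} [Fintype ι]
    (z : ι → P.ring)
    (hz : LinearIndependent K fun i => Ideal.Quotient.mk (Ideal.span {y}) (z i)) (d : ℕ) :
    ∀ g : ι → K[X], (∀ i, (g i).natDegree ≤ d) → ∑ i, aeval y (g i) * z i = 0 → ∀ i, g i = 0 := by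
  have key : ∀ g : ι → K[X], ∑ i, aeval y (g i) * z i = 0 →
      (∀ i, (g i).coeff 0 = 0) ∧ ∑ i, aeval y (g i).divX * z i = 0 := by
    intro g hg
    have hdiv : ∀ i, aeval y (g i) = y * aeval y (g i).divX + algebraMap K _ ((g i).coeff 0) := by
      intro i
      have h := congrArg (aeval y) (X_mul_divX_add (g i))
      rw [map_add, map_mul, aeval_X, aeval_C] at h
      exact h.symm
    have h0 : ∀ i, (g i).coeff 0 = 0 := by
      refine Fintype.linearIndependent_iff.mp hz _ ?_
      have h1 := congrArg (Ideal.Quotient.mk (Ideal.span {y})) hg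
      have hy : Ideal.Quotient.mk (Ideal.span {y}) y = 0 :=
        Ideal.Quotient.eq_zero_iff_mem.mpr (Ideal.mem_span_singleton_self y)
      rw [map_sum, map_zero] at h1
      rw [← h1]
      refine Finset.sum_congr rfl fun i _ => ?_
      rw [hdiv i, map_mul, map_add, map_mul, hy, zero_mul, zero_add, Algebra.smul_def]
      rfl
    refine ⟨h0, mul_left_cancel₀ hy0 ?_⟩
    rw [mul_zero, ← hg, Finset.mul_sum]
    refine Finset.sum_congr rfl fun i _ => ?_
    rw [hdiv i, h0 i, map_zero, add_zero, mul_assoc]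
  induction d with
  | zero =>
    intro g hd hg i
    rw [eq_C_of_natDegree_le_zero (hd i), (key g hg).1 i, C_0]
  | succ d ih =>
    intro g hd hg i
    obtain ⟨h0, h1⟩ := key g hg
    have h2 := ih (fun i => (g i).divX) (fun i => by
      rw [natDegree_divX_eq_natDegree_tsub_one]; have := hd i; omega) h1 i
    rw [← X_mul_divX_add (g i), h0 i, h2, mul_zero, C_0, add_zero]

theorem finite_quotient [IsAlgFunctionField K F] (P : Place K F) {y : P.ring} (hy0 : y ≠ 0)
    (hy : y ∈ IsLocalRing.maximalIdeal P.ring) :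
    FiniteDimensional K (P.ring ⧸ Ideal.span {y}) := by
  have hfin := finite_adjoin_of_transcendental (P.transcendental_of_mem hy0 hy)
  have hrank : Module.rank K (P.ring ⧸ Ideal.span {y}) ≤
      (Module.finrank (IntermediateField.adjoin K ({(y : F)} : Set F)) F : ℕ) := by
    refine rank_le fun s hs => ?_
    choose z hz using fun i : s => Ideal.Quotient.mk_surjective (i : P.ring ⧸ Ideal.span {y})
    have hli : LinearIndependent K fun i => Ideal.Quotient.mk (Ideal.span {y}) (z i) := by
      simpa only [hz] using hs
    have hA : LinearIndependent (Algebra.adjoin K ({(y : F)} : Set F)) fun i => (z i : F) := by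
      refine Fintype.linearIndependent_iff.mpr fun a ha => ?_
      have hg : ∀ i, ∃ g : K[X], aeval (y : F) g = (a i : F) := by
        intro i
        have := (Algebra.adjoin_singleton_eq_range_aeval K (y : F)).le (a i).2
        exact this
      choose g hg using hg
      have hcoe : ∀ i, ((aeval y (g i) : P.ring) : F) = a i := by
        intro i
        rw [← hg i]
        exact (aeval_algebraMap_apply F y (g i)).symm
      have h0 := P.eq_zero_of_sum_aeval hy0 z hli (Finset.univ.sup fun i => (g i).natDegree) g
        (fun i => Finset.le_sup (f := fun i => (g i).natDegree) (Finset.mem_univ i)) (by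
          apply Subtype.ext
          rw [← P.ring.subtype_apply, map_sum]
          refine Eq.trans (Finset.sum_congr rfl fun i _ => ?_) ha
          rw [map_mul, P.ring.subtype_apply, P.ring.subtype_apply, hcoe i]
          rfl)
      intro i
      apply Subtype.ext
      rw [← hg i, h0 i, map_zero]
      rfl
    have hB := (LinearIndependent.iff_fractionRing (Algebra.adjoin K ({(y : F)} : Set F))
      (IntermediateField.adjoin K ({(y : F)} : Set F))).mp hA
    simpa using hB.fintype_card_le_finrank
  exact Module.rank_lt_aleph0_iff.mp (hrank.trans_lt (Cardinal.natCast_lt_aleph0 ..))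

instance [IsAlgFunctionField K F] (P : Place K F) : IsDiscreteValuationRing P.ring := by
  have hnf : ¬ IsField P.ring := by
    intro hf
    refine P.ring_ne_top (eq_top_iff.mpr fun x _ => ?_)
    rcases P.ring.mem_or_inv_mem x with hx | hx
    · exact hx
    · by_cases hx0 : x = 0
      · rw [hx0]; exact P.ring.zero_mem
      · obtain ⟨b, hb⟩ := hf.mul_inv_cancel (a := (⟨x⁻¹, hx⟩ : P.ring))
          (fun h => inv_ne_zero hx0 (congrArg Subtype.val h))
        have hb' : x⁻¹ * (b : F) = 1 := congrArg Subtype.val hb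
        have : (b : F) = x := by
          field_simp at hb'; exact hb'
        exact this ▸ b.2
  have hN : IsNoetherianRing P.ring := by
    refine (isNoetherianRing_iff_ideal_fg _).mpr fun I => ?_
    by_cases hI : I = ⊤
    · rw [hI]; exact ⟨{1}, by simp⟩
    by_cases hI0 : I = ⊥
    · rw [hI0]; exact Submodule.fg_bot
    obtain ⟨y, hyI, hy0⟩ := Submodule.exists_mem_ne_zero_of_ne_bot hI0
    have hy := IsLocalRing.le_maximalIdeal hI hyI
    have := P.finite_quotient hy0 hy
    have hNq : IsNoetherian P.ring (P.ring ⧸ Ideal.span {y}) :=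
      isNoetherian_of_tower K (inferInstance : IsNoetherian K (P.ring ⧸ Ideal.span {y}))
    refine Submodule.fg_of_fg_map_of_fg_inf_ker (Submodule.mkQ (Ideal.span {y}))
      (IsNoetherian.noetherian _) ?_
    rw [Submodule.ker_mkQ, inf_eq_right.mpr ((Ideal.span_singleton_le_iff_mem I).mpr hyI)]
    exact ⟨{y}, by simp⟩
  exact ((IsDiscreteValuationRing.TFAE P.ring hnf).out 0 1).mpr
    (inferInstance : ValuationRing P.ring)

/-- The normalized discrete valuation `v_P : F → ℤ ∪ {∞}`, with `v_P(0) = ∞` and `v_P(t) = 1` for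
a generator `t` of the maximal ideal. It is Mathlib's valuation of the maximal ideal of the discrete
valuation ring `𝒪_P`, written additively. -/
noncomputable def ord [IsAlgFunctionField K F] (P : Place K F) (x : F) : WithTop ℤ :=
  open Classical in
  if x = 0 then ⊤ else
    ((-WithZero.log ((IsDiscreteValuationRing.maximalIdeal P.ring).valuation F x) : ℤ) : WithTop ℤ)

theorem le_ord_iff [IsAlgFunctionField K F] (P : Place K F) (x : F) (n : ℤ) :
    (n : WithTop ℤ) ≤ P.ord x ↔
      (IsDiscreteValuationRing.maximalIdeal P.ring).valuation F x ≤ WithZero.exp (-n) := by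
  unfold ord
  split_ifs with hx
  · simp [hx]
  · rw [WithTop.coe_le_coe, le_neg,
      WithZero.log_le_iff_le_exp ((Valuation.ne_zero_iff _).mpr hx)]

theorem value_eq_coe_iff (P : Place K F) (x : F) (r : P.residueField) :
    P.value x = (r : WithTop P.residueField) ↔
      ∃ h : x ∈ P.ring, IsLocalRing.residue P.ring ⟨x, h⟩ = r := by
  unfold value
  split_ifs with hx
  · rw [WithTop.coe_inj]
    exact ⟨fun h => ⟨hx, h⟩, fun ⟨_, h⟩ => h⟩
  · simp [hx]

end Place

/-- The divisor group of `F / K`: the free abelian group on the places. -/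
abbrev Divisor (K F : Type*) [Field K] [Field F] [Algebra K F] : Type _ := Place K F →₀ ℤ

namespace Divisor

variable {K F : Type*} [Field K] [Field F] [Algebra K F]

/-- The degree `∑ v_P(A) · deg P` of a divisor `A`. -/
noncomputable def degree (A : Divisor K F) : ℤ := A.sum fun P m => m * (P.degree : ℤ)

/-- The space `L(A) = {x ∈ F : (x) ≥ -A} ∪ {0}`; the inequality of divisors says that
`v_P(x) ≥ -v_P(A)` at every place `P`, and holds for `x = 0` because `v_P(0) = ∞`. -/
noncomputable def riemannRochSpace [IsAlgFunctionField K F] (A : Divisor K F) :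
    Submodule K F where
  carrier := {x | ∀ P : Place K F, ((-A P : ℤ) : WithTop ℤ) ≤ P.ord x}
  zero_mem' P := by simp [Place.ord]
  add_mem' {x y} hx hy P := by
    rw [Place.le_ord_iff]
    exact Valuation.map_add_le _ ((P.le_ord_iff _ _).mp (hx P)) ((P.le_ord_iff _ _).mp (hy P))
  smul_mem' a x hx P := by
    have h1 : (IsDiscreteValuationRing.maximalIdeal P.ring).valuation F (algebraMap K F a) ≤ 1 :=
      IsDedekindDomain.HeightOneSpectrum.valuation_le_one _ (algebraMap K P.ring a)
    rw [Place.le_ord_iff, Algebra.smul_def, Valuation.map_mul]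
    calc _ ≤ 1 * _ := mul_le_mul_left h1 _
      _ ≤ _ := by rw [one_mul]; exact (P.le_ord_iff _ _).mp (hx P)

/-- The dimension of a divisor: the dimension of `L(A)` over `K`. -/
noncomputable def dim [IsAlgFunctionField K F] (A : Divisor K F) : ℕ :=
  Module.finrank K A.riemannRochSpace

end Divisor

/-- The geometric Goppa code `C(D, G) = {(x(P₁), …, x(Pₙ)) : x ∈ L(G)} ⊆ Kⁿ` for `D = P₁ + ⋯ + Pₙ`;
the value `x(Pᵢ)` is identified with the element of `K` that maps to it in the residue class
field. -/
noncomputable def goppaCode {K F : Type*} [Field K] [Field F] [Algebra K F]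
    [IsAlgFunctionField K F] {n : ℕ} (P : Fin n → Place K F) (G : Divisor K F) :
    Submodule K (Fin n → K) where
  carrier := {c | ∃ x ∈ G.riemannRochSpace, ∀ i, (P i).value x =
    ((algebraMap K (P i).residueField (c i) : (P i).residueField) : WithTop (P i).residueField)}
  zero_mem' := ⟨0, zero_mem _, fun i => ((P i).value_eq_coe_iff _ _).mpr
    ⟨zero_mem _, by rw [Pi.zero_apply, map_zero]; exact map_zero _⟩⟩
  add_mem' := by
    rintro c c' ⟨x, hx, h⟩ ⟨y, hy, h'⟩
    refine ⟨x + y, add_mem hx hy, fun i => ((P i).value_eq_coe_iff _ _).mpr ?_⟩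
    obtain ⟨hxi, h1⟩ := ((P i).value_eq_coe_iff _ _).mp (h i)
    obtain ⟨hyi, h2⟩ := ((P i).value_eq_coe_iff _ _).mp (h' i)
    refine ⟨add_mem hxi hyi, ?_⟩
    rw [Pi.add_apply, map_add, ← h1, ← h2, ← map_add]
    rfl
  smul_mem' := by
    rintro a c ⟨x, hx, h⟩
    refine ⟨a • x, Submodule.smul_mem _ a hx, fun i => ((P i).value_eq_coe_iff _ _).mpr ?_⟩
    obtain ⟨hxi, h1⟩ := ((P i).value_eq_coe_iff _ _).mp (h i)
    have hm : a • x ∈ (P i).ring := by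
      rw [Algebra.smul_def]
      exact mul_mem ((P i).algebraMap_mem a) hxi
    refine ⟨hm, ?_⟩
    have h2 : (⟨a • x, hm⟩ : (P i).ring) = algebraMap K (P i).ring a * ⟨x, hxi⟩ :=
      Subtype.ext (Algebra.smul_def a x)
    rw [h2, map_mul, h1, Pi.smul_apply, smul_eq_mul, map_mul]
    rfl

open Classical in
/-- `d` is the minimum distance of the code `C`: the least Hamming distance between two different
codewords. A code with a single codeword has no minimum distance. -/
def IsMinDist {K : Type*} [Field K] {n : ℕ} (C : Submodule K (Fin n → K)) (d : ℕ) : Prop :=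
  IsLeast {m : ℕ | ∃ x ∈ C, ∃ y ∈ C, x ≠ y ∧ hammingDist x y = m} d

open Polynomial
open scoped WithZero

/-! Since $G$ has coefficient zero at each $P_i$, functions in $L(G)$ are regular there, and degree
one identifies the residue fields with $K$. Evaluation is then a $K$-linear map $L(G)\to K^n$ with
image the code and kernel $L(G-D)$, so rank–nullity gives the dimension. If two distinct codewords
agree exactly on $s$, their difference comes from a nonzero $x\in L(G-\sum_{i\in s}P_i)$, and
`Divisor.degree_nonneg_of_mem` gives $|s|\le\deg G$.

That lemma needs only $\deg(x)\le 0$, proved for transcendental $x$ by comparing zeros and poles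
with $[F:K(x)]$. Zeros (`Place.sum_intOrd_mul_degree_le`): by weak approximation the functions
regular at given zeros surject onto $\prod\mathcal O_P/(x)$, whose dimension counts those zeros, and
independence modulo $x$ lifts to independence over $K(x)$. Poles
(`Divisor.le_degree_neg_principal_sup_zero`): for a basis $u_j$ of $F/K(x)$, the products $x^iu_j$
with $i\le r$ are independent in a space whose dimension is at most $r$ times the pole degree plus a
constant. This uses $\dim L(A)\le 1+\deg A$ for $A\ge 0$ (`Divisor.dim_le_one_add_degree`), obtained
by adding places one at a time to $L(0)$, which contains only constants because every transcendental
element has a pole. -/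

theorem Transcendental.linearIndependent_pow {K L : Type*} [Field K] [Field L] [Algebra K L] {y : L}
    (hy : Transcendental K y) : LinearIndependent K fun i : ℕ => y ^ i := by
  have h := (Polynomial.basisMonomials K).linearIndependent.map' (Polynomial.aeval y).toLinearMap
    (LinearMap.ker_eq_bot.mpr (transcendental_iff_injective.mp hy))
  have he : (Polynomial.aeval y).toLinearMap ∘ Polynomial.basisMonomials K = fun i : ℕ => y ^ i :=
    funext fun i => by simp
  rwa [he] at h

/-! ### Independence over $K(y)$ and existence of poles -/

namespace Place

variable {K F : Type*} [Field K] [Field F] [Algebra K F]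

open scoped IntermediateField.algebraAdjoinAdjoin in
/-- If `y` is transcendental over `K` and lies in a `K`-subalgebra `A` of `F`, a family in `A` that
is linearly independent over `K` modulo `y` is linearly independent over `K(y)`. -/
theorem linearIndependent_adjoin_of_quotient (A : Subalgebra K F) {y : A}
    (hy : Transcendental K (y : F)) {ι : Type*} [Fintype ι] (z : ι → A)
    (hz : LinearIndependent K fun i => Ideal.Quotient.mk (Ideal.span {y}) (z i)) :
    LinearIndependent (IntermediateField.adjoin K ({(y : F)} : Set F)) fun i => (z i : F) := by
  have hy0 : y ≠ 0 := by
    rintro rfl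
    exact hy isAlgebraic_zero
  -- Reducing a relation modulo `y` kills the constant coefficients; cancelling `y` leaves a
  -- relation of lower degree, so induction on a degree bound applies.
  have key : ∀ g : ι → K[X], ∑ i, aeval y (g i) * z i = 0 →
      (∀ i, (g i).coeff 0 = 0) ∧ ∑ i, aeval y (g i).divX * z i = 0 := by
    intro g hg
    have hdiv : ∀ i, aeval y (g i) = y * aeval y (g i).divX + algebraMap K _ ((g i).coeff 0) := by
      intro i
      have h := congrArg (aeval y) (X_mul_divX_add (g i))
      rw [map_add, map_mul, aeval_X, aeval_C] at h
      exact h.symm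
    have h0 : ∀ i, (g i).coeff 0 = 0 := by
      refine Fintype.linearIndependent_iff.mp hz _ ?_
      have h1 := congrArg (Ideal.Quotient.mk (Ideal.span {y})) hg
      have hy : Ideal.Quotient.mk (Ideal.span {y}) y = 0 :=
        Ideal.Quotient.eq_zero_iff_mem.mpr (Ideal.mem_span_singleton_self y)
      rw [map_sum, map_zero] at h1
      rw [← h1]
      refine Finset.sum_congr rfl fun i _ => ?_
      rw [hdiv i, map_mul, map_add, map_mul, hy, zero_mul, zero_add, ← map_mul, ← Algebra.smul_def]
      rfl
    refine ⟨h0, mul_left_cancel₀ hy0 ?_⟩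
    rw [mul_zero, ← hg, Finset.mul_sum]
    refine Finset.sum_congr rfl fun i _ => ?_
    rw [hdiv i, h0 i, map_zero, add_zero, mul_assoc]
  have main : ∀ (d : ℕ) (g : ι → K[X]), (∀ i, (g i).natDegree ≤ d) →
      ∑ i, aeval y (g i) * z i = 0 → ∀ i, g i = 0 := by
    intro d
    induction d with
    | zero =>
      intro g hd hg i
      rw [eq_C_of_natDegree_le_zero (hd i), (key g hg).1 i, C_0]
    | succ d ih =>
      intro g hd hg i
      obtain ⟨h0, h1⟩ := key g hg
      have h2 := ih (fun i => (g i).divX) (fun i => by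
        rw [natDegree_divX_eq_natDegree_tsub_one]; have := hd i; omega) h1 i
      rw [← X_mul_divX_add (g i), h0 i, h2, mul_zero, C_0, add_zero]
  -- Clearing denominators reduces independence over $K(y)$ to independence over $K[y]$.
  refine (LinearIndependent.iff_fractionRing (Algebra.adjoin K ({(y : F)} : Set F))
      (IntermediateField.adjoin K ({(y : F)} : Set F))).mp ?_
  refine Fintype.linearIndependent_iff.mpr fun a ha => ?_
  have hg : ∀ i, ∃ g : K[X], aeval (y : F) g = (a i : F) := fun i =>
    (Algebra.adjoin_singleton_eq_range_aeval K (y : F)).le (a i).2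
  choose g hg using hg
  have hcoe : ∀ i, ((aeval y (g i) : A) : F) = a i := fun i => by
    rw [← hg i]
    exact (aeval_algebraMap_apply F y (g i)).symm
  have h0 := main (Finset.univ.sup fun i => (g i).natDegree) g
    (fun i => Finset.le_sup (f := fun i => (g i).natDegree) (Finset.mem_univ i)) (by
      apply Subtype.ext
      rw [← A.coe_val, map_sum]
      refine Eq.trans (Finset.sum_congr rfl fun i _ => ?_) ha
      rw [map_mul, A.coe_val, hcoe i]
      rfl)
  intro i
  apply Subtype.ext
  rw [← hg i, h0 i, map_zero]
  rfl

/-- The map `f` factors through $A/yA$, so lifts of a basis of `V` are independent modulo `y`, hence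
over $K(y)$. -/
theorem finrank_le_of_surjective_quotient [IsAlgFunctionField K F] (A : Subalgebra K F) {y : A}
    (hy : Transcendental K (y : F)) {V : Type*} [AddCommGroup V] [Module K V] [Module.Finite K V]
    (f : A →ₗ[K] V) (hf : Function.Surjective f) (hfy : ∀ a, f (y * a) = 0) :
    Module.finrank K V ≤ Module.finrank (IntermediateField.adjoin K ({(y : F)} : Set F)) F := by
  have := finite_adjoin_of_transcendental hy
  let b := Module.finBasis K V
  choose z hz using fun i => hf (b i)
  have hli : LinearIndependent K fun i => Ideal.Quotient.mk (Ideal.span {y}) (z i) := by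
    refine Fintype.linearIndependent_iff.mpr fun c hc => ?_
    refine Fintype.linearIndependent_iff.mp b.linearIndependent c ?_
    have h1 : Ideal.Quotient.mk (Ideal.span {y}) (∑ i, c i • z i) = 0 := by
      rw [map_sum, ← hc]
      rfl
    obtain ⟨a, ha⟩ := Ideal.mem_span_singleton.mp (Ideal.Quotient.eq_zero_iff_mem.mp h1)
    rw [← hfy a, ← ha, map_sum]
    simp only [map_smul, hz]
  simpa using (linearIndependent_adjoin_of_quotient A hy z hli).fintype_card_le_finrank

/-- An element that is transcendental over `K` has a pole. -/
theorem exists_notMem_ring_of_transcendental {x : F} (hx : Transcendental K x) :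
    ∃ P : Place K F, x ∉ P.ring := by
  let R : Subring F := (integralClosure K F).toSubring
  have hR : IsIntegrallyClosedIn R F :=
    inferInstanceAs (IsIntegrallyClosedIn (integralClosure K F) F)
  have hxR : x ∉ R := fun h => hx (IsIntegral.isAlgebraic h)
  -- An integrally closed subring is the intersection of the valuation rings above it, so some
  -- valuation ring containing the constants omits `x`.
  obtain ⟨V, hV, hxV⟩ := R.exists_le_valuationSubring_of_isIntegrallyClosedIn hxR
  have hinv : x⁻¹ ∈ V := (V.mem_or_inv_mem x).resolve_left hxV
  refine ⟨⟨V, SetLike.lt_iff_le_and_exists.mpr ⟨?_, x⁻¹, hinv, ?_⟩, fun h => hxV ?_⟩, hxV⟩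
  · rintro _ ⟨a, rfl⟩
    exact hV (_root_.algebraMap_mem (integralClosure K F) a)
  · rintro ⟨a, ha⟩
    refine hx ?_
    rw [← inv_inv x, ← ha, ← map_inv₀]
    exact isAlgebraic_algebraMap _
  · rw [h]
    trivial

/-! ### Valuations and weak approximation -/

variable [IsAlgFunctionField K F]

/-- The valuation of a place, written multiplicatively. -/
noncomputable abbrev val (P : Place K F) : Valuation F ℤᵐ⁰ :=
  (IsDiscreteValuationRing.maximalIdeal P.ring).valuation F

theorem mem_ring_iff (P : Place K F) {x : F} : x ∈ P.ring ↔ P.val x ≤ 1 := by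
  refine ⟨fun h => ?_, fun h => ?_⟩
  · exact IsDedekindDomain.HeightOneSpectrum.valuation_le_one _ (⟨x, h⟩ : P.ring)
  · obtain ⟨a, rfl⟩ := IsDiscreteValuationRing.exists_lift_of_le_one h
    exact a.2

theorem residue_eq_zero_iff (P : Place K F) (x : P.ring) :
    IsLocalRing.residue P.ring x = 0 ↔ P.val x < 1 := by
  rw [IsLocalRing.residue_eq_zero_iff]
  exact (IsDedekindDomain.HeightOneSpectrum.valuation_lt_one_iff_mem
    (IsDiscreteValuationRing.maximalIdeal P.ring) x).symm

theorem exists_val_eq_exp (P : Place K F) (m : ℤ) : ∃ t : F, P.val t = WithZero.exp m :=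
  IsDedekindDomain.HeightOneSpectrum.valuation_surjective F _ _

theorem eq_of_val_le_one_iff {P Q : Place K F} (h : ∀ x, P.val x ≤ 1 ↔ Q.val x ≤ 1) : P = Q := by
  ext x
  rw [mem_ring_iff, mem_ring_iff, h]

/-- Weak approximation for places. -/
theorem exists_val_sub_le {ι : Type*} [Finite ι] {P : ι → Place K F} (hP : Function.Injective P)
    (a : ι → F) {y : F} (hy : y ≠ 0) : ∃ z, ∀ i, (P i).val (z - a i) ≤ (P i).val y := by
  have := Fintype.ofFinite ι
  have hb : (1 : NNReal) < 2 := by norm_num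
  let v : ι → AbsoluteValue F ℝ := fun i =>
    (IsDiscreteValuationRing.maximalIdeal (P i).ring).adicAbv hb
  have hmono := WithZeroMulInt.toNNReal_strictMono hb
  have hle : ∀ i x z, v i x ≤ v i z ↔ (P i).val x ≤ (P i).val z := fun i x z =>
    NNReal.coe_le_coe.trans hmono.le_iff_le
  have hle1 : ∀ i x, v i x ≤ 1 ↔ (P i).val x ≤ 1 := fun i x => by
    rw [← map_one (v i), hle, map_one]
  have hnt : ∀ i, (v i).IsNontrivial := fun i => by
    obtain ⟨t, ht⟩ := (P i).exists_val_eq_exp 1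
    refine ⟨t, ?_, fun h => ?_⟩
    · rintro rfl
      exact WithZero.exp_ne_zero ((map_zero _).symm.trans ht).symm
    · have h1 := (hle1 i t).mp h.le
      rw [ht, ← WithZero.exp_zero, WithZero.exp_le_exp] at h1
      omega
  -- Equivalent absolute values have the same closed unit ball, which here is the valuation ring and
  -- determines the place.
  have hne : Pairwise fun i j => ¬ (v i).IsEquiv (v j) := fun i j hij h => hij <| hP <|
    eq_of_val_le_one_iff fun x => by rw [← hle1, ← hle1, h.le_one_iff]
  have hd := AbsoluteValue.denseRange_algebraMap_pi hnt hne
  have hpos : ∃ ε > 0, ∀ i, ε ≤ v i y := by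
    rcases isEmpty_or_nonempty ι with hι | hι
    · exact ⟨1, one_pos, fun i => hι.elim i⟩
    · obtain ⟨i, hi⟩ := Finite.exists_min fun i => v i y
      exact ⟨v i y, (v i).pos hy, hi⟩
  obtain ⟨ε, hε, hεi⟩ := hpos
  obtain ⟨z, hz⟩ := Metric.denseRange_iff.mp hd (fun i => WithAbs.toAbs (v i) (a i)) ε hε
  refine ⟨z, fun i => (hle i _ _).mp (le_trans ?_ (hεi i))⟩
  have h := (dist_pi_lt_iff hε).mp hz i
  rw [dist_comm, dist_eq_norm] at h
  exact h.le

/-- The order of `x` at a place as an integer (with the value `0` at `x = 0`). -/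
noncomputable def intOrd (P : Place K F) (x : F) : ℤ := -WithZero.log (P.val x)

theorem val_eq_exp_neg_intOrd (P : Place K F) {x : F} (hx : x ≠ 0) :
    P.val x = WithZero.exp (-P.intOrd x) := by
  rw [intOrd, neg_neg, WithZero.exp_log ((Valuation.ne_zero_iff _).mpr hx)]

theorem intOrd_inv (P : Place K F) (x : F) : P.intOrd x⁻¹ = -P.intOrd x := by
  rw [intOrd, intOrd, map_inv₀, WithZero.log_inv]

theorem val_lt_one_iff (P : Place K F) {x : F} (hx : x ≠ 0) : P.val x < 1 ↔ 0 < P.intOrd x := by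
  rw [P.val_eq_exp_neg_intOrd hx, ← WithZero.exp_zero, WithZero.exp_lt_exp, neg_lt_zero]

theorem val_le_exp_iff (P : Place K F) {x : F} (hx : x ≠ 0) (m : ℤ) :
    P.val x ≤ WithZero.exp m ↔ -m ≤ P.intOrd x := by
  rw [P.val_eq_exp_neg_intOrd hx, WithZero.exp_le_exp, neg_le]

/-! ### Degrees of places and the count of zeros -/

/-- The residue field is a quotient of the finite-dimensional $\mathcal O_P/(t)$ for a uniformizer
$t$, so its `finrank` is not the default value 0. -/
theorem degree_pos (P : Place K F) : 0 < P.degree := by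
  obtain ⟨t, ht⟩ := P.exists_val_eq_exp (-1)
  have ht1 : P.val t < 1 := by
    rw [ht, ← WithZero.exp_zero, WithZero.exp_lt_exp]
    omega
  have ht0 : t ≠ 0 := by
    rintro rfl
    exact WithZero.exp_ne_zero ((map_zero _).symm.trans ht).symm
  let y : P.ring := ⟨t, P.mem_ring_iff.mpr ht1.le⟩
  have hy : y ∈ IsLocalRing.maximalIdeal P.ring := by
    rw [← IsLocalRing.residue_eq_zero_iff, P.residue_eq_zero_iff]
    exact ht1
  have := P.finite_quotient (fun h => ht0 (congrArg Subtype.val h)) hy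
  have hle : Ideal.span {y} ≤ IsLocalRing.maximalIdeal P.ring :=
    (Ideal.span_singleton_le_iff_mem _).mpr hy
  have : FiniteDimensional K P.residueField :=
    Module.Finite.of_surjective (Ideal.Quotient.factorₐ K hle).toLinearMap
      (Ideal.Quotient.factor_surjective hle)
  exact Module.finrank_pos

instance finite_residueField (P : Place K F) : FiniteDimensional K P.residueField :=
  Module.finite_of_finrank_pos P.degree_pos

/-- If $k$ is the order of $y$, the quotient is $\mathcal O_P/\mathfrak m^k$. As $K$ is finite,
dimensions can be read off from $|\mathcal O_P/\mathfrak m^k|=|\mathcal O_P/\mathfrak m|^k$. -/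
theorem finrank_quotient_span [Finite K] (P : Place K F) {y : P.ring} (hy0 : y ≠ 0)
    (hy : y ∈ IsLocalRing.maximalIdeal P.ring) :
    (Module.finrank K (P.ring ⧸ Ideal.span {y}) : ℤ) = P.intOrd y * P.degree := by
  have hfin := P.finite_quotient hy0 hy
  obtain ⟨t, ht⟩ := IsDiscreteValuationRing.exists_irreducible P.ring
  obtain ⟨k, u, rfl⟩ := IsDiscreteValuationRing.eq_unit_mul_pow_irreducible hy0 ht
  have hspan : Ideal.span {(u : P.ring) * t ^ k} = IsLocalRing.maximalIdeal P.ring ^ k := by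
    rw [ht.maximalIdeal_eq, Ideal.span_singleton_pow]
    exact Ideal.span_singleton_mul_left_unit u.isUnit _
  have hvt : P.val t = WithZero.exp (-1) := by
    rw [val]
    erw [IsDedekindDomain.HeightOneSpectrum.valuation_of_algebraMap]
    exact IsDedekindDomain.HeightOneSpectrum.intValuation_singleton _ ht.ne_zero ht.maximalIdeal_eq
  have hvu : P.val (u : P.ring) = 1 := by
    erw [IsDedekindDomain.HeightOneSpectrum.valuation_eq_one_iff_notMem]
    exact fun h => (IsLocalRing.mem_maximalIdeal _).mp h u.isUnit
  have hord : P.intOrd ((u : P.ring) * t ^ k : P.ring) = k := by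
    rw [intOrd, MulMemClass.coe_mul, SubmonoidClass.coe_pow, map_mul, map_pow, hvu, hvt, one_mul,
      WithZero.log_pow, WithZero.log_exp]
    simp
  have hcard : Nat.card K ^ Module.finrank K (P.ring ⧸ Ideal.span {(u : P.ring) * t ^ k}) =
      Nat.card K ^ (P.degree * k) := by
    rw [← Module.natCard_eq_pow_finrank, hspan, pow_mul, degree, ← Module.natCard_eq_pow_finrank]
    exact cardQuot_pow_of_prime (IsDiscreteValuationRing.maximalIdeal P.ring).ne_bot
  rw [Nat.pow_right_injective Finite.one_lt_card hcard, hord]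
  push_cast
  ring

/-- The zeros of `y`, counted with multiplicity and degree, are at most `[F : K(y)]` in number. -/
theorem sum_intOrd_mul_degree_le [Finite K] {ι : Type*} [Fintype ι] {P : ι → Place K F}
    (hP : Function.Injective P) {y : F} (hy : Transcendental K y) (h : ∀ i, (P i).val y < 1) :
    ∑ i, (P i).intOrd y * (P i).degree ≤
      Module.finrank (IntermediateField.adjoin K ({y} : Set F)) F := by
  have hy0 : y ≠ 0 := by
    rintro rfl
    exact hy isAlgebraic_zero
  -- The functions regular at all the given places.
  let A : Subalgebra K F :=
    { carrier := {x | ∀ i, x ∈ (P i).ring}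
      mul_mem' := fun ha hb i => mul_mem (ha i) (hb i)
      add_mem' := fun ha hb i => add_mem (ha i) (hb i)
      algebraMap_mem' := fun a i => (P i).algebraMap_mem a }
  have hyA : y ∈ A := fun i => (P i).mem_ring_iff.mpr (h i).le
  let Y : ∀ i, (P i).ring := fun i => ⟨y, hyA i⟩
  have hY0 : ∀ i, Y i ≠ 0 := fun i h => hy0 (congrArg Subtype.val h)
  have hYm : ∀ i, Y i ∈ IsLocalRing.maximalIdeal (P i).ring := fun i => by
    rw [← IsLocalRing.residue_eq_zero_iff, (P i).residue_eq_zero_iff]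
    exact h i
  have hmk : ∀ i (a b : (P i).ring), Ideal.Quotient.mk (Ideal.span {Y i}) a =
      Ideal.Quotient.mk (Ideal.span {Y i}) b ↔ (P i).val ((a : F) - b) ≤ (P i).val y := by
    intro i a b
    rw [Ideal.Quotient.eq, Ideal.mem_span_singleton]
    constructor
    · rintro ⟨c, hc⟩
      have hc' : (a : F) - b = y * c := congrArg Subtype.val hc
      rw [hc', map_mul]
      exact mul_le_of_le_one_right' ((P i).mem_ring_iff.mp c.2)
    · intro hle
      have hc : ((a : F) - b) / y ∈ (P i).ring := by
        rw [mem_ring_iff, map_div₀]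
        exact div_le_one_of_le₀ hle zero_le
      exact ⟨⟨_, hc⟩, Subtype.ext (mul_div_cancel₀ _ hy0).symm⟩
  have hfin : ∀ i, FiniteDimensional K ((P i).ring ⧸ Ideal.span {Y i}) :=
    fun i => (P i).finite_quotient (hY0 i) (hYm i)
  let f : A →ₗ[K] (∀ i, (P i).ring ⧸ Ideal.span {Y i}) :=
    { toFun := fun x i => Ideal.Quotient.mk (Ideal.span {Y i}) ⟨x, x.2 i⟩
      map_add' := fun a b => funext fun i =>
        map_add (Ideal.Quotient.mk (Ideal.span {Y i})) ⟨a, a.2 i⟩ ⟨b, b.2 i⟩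
      map_smul' := fun c x => funext fun i => by
        change _ = Ideal.Quotient.mk (Ideal.span {Y i}) (c • ⟨x, x.2 i⟩)
        congr 1
        exact Subtype.ext ((P i).coe_smul c ⟨x, x.2 i⟩).symm }
  -- Approximating to within the size of `y` means congruence modulo `y`; since `y` is small at each
  -- place, the approximant stays in `A`.
  have hf : Function.Surjective f := by
    intro w
    choose a ha using fun i => Ideal.Quotient.mk_surjective (w i)
    obtain ⟨z, hz⟩ := exists_val_sub_le hP (fun i => (a i : F)) hy0
    have hzA : z ∈ A := fun i => by
      rw [← sub_add_cancel z (a i : F)]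
      exact add_mem ((P i).mem_ring_iff.mpr ((hz i).trans (h i).le)) (a i).2
    exact ⟨⟨z, hzA⟩, funext fun i => ((hmk i ⟨z, hzA i⟩ (a i)).mpr (hz i)).trans (ha i)⟩
  have hfy : ∀ a, f (⟨y, hyA⟩ * a) = 0 := fun a => funext fun i =>
    Ideal.Quotient.eq_zero_iff_mem.mpr
      (Ideal.mul_mem_right (⟨a, a.2 i⟩ : (P i).ring) _ (Ideal.mem_span_singleton_self (Y i)))
  have key := finrank_le_of_surjective_quotient A (y := ⟨y, hyA⟩) hy f hf hfy
  rw [Module.finrank_pi_fintype] at key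
  refine le_trans (le_of_eq ?_) (Nat.cast_le.mpr key)
  rw [Nat.cast_sum]
  exact Finset.sum_congr rfl fun i _ => ((P i).finrank_quotient_span (hY0 i) (hYm i)).symm

theorem transcendental_of_val_lt_one (P : Place K F) {x : F} (hx0 : x ≠ 0) (hx : P.val x < 1) :
    Transcendental K x := by
  refine P.transcendental_of_mem (y := ⟨x, P.mem_ring_iff.mpr hx.le⟩)
    (fun h => hx0 (congrArg Subtype.val h)) ?_
  rw [← IsLocalRing.residue_eq_zero_iff, P.residue_eq_zero_iff]
  exact hx

theorem intOrd_eq_zero_of_isAlgebraic (P : Place K F) {x : F} (hx : IsAlgebraic K x) :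
    P.intOrd x = 0 := by
  rcases eq_or_ne x 0 with rfl | hx0
  · simp [intOrd]
  refine le_antisymm ?_ ?_
  · by_contra! h
    exact P.transcendental_of_val_lt_one hx0 ((P.val_lt_one_iff hx0).mpr h) hx
  · by_contra! h
    refine P.transcendental_of_val_lt_one (inv_ne_zero hx0)
      ((P.val_lt_one_iff (inv_ne_zero hx0)).mpr ?_) hx.inv
    rw [intOrd_inv]
    omega

variable [Finite K]

/-- Every zero contributes at least 1 to a sum bounded by $[F:K(x)]$; algebraic elements have no
zeros. -/
theorem finite_setOf_val_lt_one {x : F} (hx : x ≠ 0) : {P : Place K F | P.val x < 1}.Finite := by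
  by_cases halg : IsAlgebraic K x
  · convert Set.finite_empty
    refine Set.eq_empty_of_forall_notMem fun P hP => P.transcendental_of_val_lt_one hx hP halg
  by_contra hinf
  obtain ⟨s, hs, hcard⟩ := Set.Infinite.exists_subset_card_eq hinf
    (Module.finrank (IntermediateField.adjoin K ({x} : Set F)) F + 1)
  have h := sum_intOrd_mul_degree_le (P := fun i : s => (i : Place K F)) Subtype.val_injective halg
    fun i => hs i.2
  have h1 : ∑ i : s, (1 : ℤ) ≤ ∑ i : s, (i : Place K F).intOrd x * (i : Place K F).degree :=
    Finset.sum_le_sum fun i _ => by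
      have h2 := ((i : Place K F).val_lt_one_iff hx).mp (hs i.2)
      have h3 := (i : Place K F).degree_pos
      nlinarith
  rw [Finset.sum_const, Finset.card_univ, Fintype.card_coe, hcard] at h1
  simp only [nsmul_eq_mul, mul_one] at h1
  push_cast at h1
  omega

theorem finite_support_intOrd (x : F) :
    (Function.support fun P : Place K F => P.intOrd x).Finite := by
  rcases eq_or_ne x 0 with rfl | hx
  · simp [intOrd, Function.support]
  refine ((finite_setOf_val_lt_one (K := K) hx).union
    (finite_setOf_val_lt_one (K := K) (inv_ne_zero hx))).subset fun P hP => ?_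
  have hP : P.intOrd x ≠ 0 := hP
  rw [Set.mem_union, Set.mem_ofPred_eq, Set.mem_ofPred_eq, P.val_lt_one_iff hx,
    P.val_lt_one_iff (inv_ne_zero hx), intOrd_inv]
  omega

end Place

/-! ### Divisors and finiteness of Riemann–Roch spaces -/

namespace Divisor

variable {K F : Type*} [Field K] [Field F] [Algebra K F]

/-- The degree as a homomorphism of groups. -/
noncomputable def degreeHom : Divisor K F →+ ℤ :=
  Finsupp.liftAddHom fun P => AddMonoidHom.mulRight (P.degree : ℤ)

theorem degreeHom_apply (A : Divisor K F) : degreeHom A = A.degree := rfl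

theorem degree_add (A B : Divisor K F) : (A + B).degree = A.degree + B.degree :=
  map_add degreeHom A B

theorem degree_sub (A B : Divisor K F) : (A - B).degree = A.degree - B.degree :=
  map_sub degreeHom A B

theorem degree_nsmul (r : ℕ) (A : Divisor K F) : (r • A).degree = r * A.degree := by
  rw [← degreeHom_apply, map_nsmul, nsmul_eq_mul, degreeHom_apply]

theorem degree_single (P : Place K F) (m : ℤ) :
    degree (Finsupp.single P m) = m * P.degree :=
  Finsupp.sum_single_index (zero_mul _)

theorem degree_nonneg {A : Divisor K F} (hA : 0 ≤ A) : 0 ≤ A.degree :=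
  Finset.sum_nonneg fun P _ => mul_nonneg (hA P) (Nat.cast_nonneg _)

theorem degree_mono {A B : Divisor K F} (h : A ≤ B) : A.degree ≤ B.degree := by
  have := degree_nonneg (sub_nonneg.mpr h)
  rw [degree_sub] at this
  omega

variable [IsAlgFunctionField K F]

theorem mem_riemannRochSpace_iff {A : Divisor K F} {x : F} :
    x ∈ A.riemannRochSpace ↔ ∀ P : Place K F, P.val x ≤ WithZero.exp (A P) := by
  refine forall_congr' fun P => ?_
  rw [P.le_ord_iff, neg_neg]

theorem riemannRochSpace_mono {A B : Divisor K F} (h : A ≤ B) :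
    A.riemannRochSpace ≤ B.riemannRochSpace := fun _ hx =>
  mem_riemannRochSpace_iff.mpr fun P =>
    (mem_riemannRochSpace_iff.mp hx P).trans (WithZero.exp_le_exp.mpr (h P))

theorem mul_mem_riemannRochSpace {A B : Divisor K F} {x y : F} (hx : x ∈ A.riemannRochSpace)
    (hy : y ∈ B.riemannRochSpace) : x * y ∈ (A + B).riemannRochSpace :=
  mem_riemannRochSpace_iff.mpr fun P => by
    rw [map_mul, Finsupp.add_apply, WithZero.exp_add]
    exact mul_le_mul' (mem_riemannRochSpace_iff.mp hx P) (mem_riemannRochSpace_iff.mp hy P)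

theorem one_mem_riemannRochSpace_zero : (1 : F) ∈ (0 : Divisor K F).riemannRochSpace :=
  mem_riemannRochSpace_iff.mpr fun P => by simp

theorem pow_mem_riemannRochSpace {A : Divisor K F} {x : F} (hx : x ∈ A.riemannRochSpace) (i : ℕ) :
    x ^ i ∈ (i • A).riemannRochSpace := by
  induction i with
  | zero => simpa using one_mem_riemannRochSpace_zero
  | succ i ih =>
    rw [pow_succ, succ_nsmul]
    exact mul_mem_riemannRochSpace ih hx

/-- A nonconstant element is transcendental, as $K$ is the full constant field, and so has a pole.
-/
theorem riemannRochSpace_zero_le (hK : algebraicClosure K F = ⊥) :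
    (0 : Divisor K F).riemannRochSpace ≤ Submodule.span K {1} := by
  intro x hx
  by_cases halg : IsAlgebraic K x
  · have h : x ∈ algebraicClosure K F := mem_algebraicClosure_iff.mpr halg
    rw [hK, IntermediateField.mem_bot] at h
    obtain ⟨a, rfl⟩ := h
    exact Submodule.mem_span_singleton.mpr ⟨a, (Algebra.algebraMap_eq_smul_one a).symm⟩
  · obtain ⟨P, hP⟩ := Place.exists_notMem_ring_of_transcendental halg
    exact (hP (P.mem_ring_iff.mpr (by simpa using mem_riemannRochSpace_iff.mp hx P))).elim

theorem finite_riemannRochSpace_zero (hK : algebraicClosure K F = ⊥) :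
    FiniteDimensional K (0 : Divisor K F).riemannRochSpace :=
  Submodule.finiteDimensional_of_le (riemannRochSpace_zero_le hK)

theorem dim_zero_le (hK : algebraicClosure K F = ⊥) : (0 : Divisor K F).dim ≤ 1 :=
  (Submodule.finrank_mono (riemannRochSpace_zero_le hK)).trans
    ((finrank_span_le_card _).trans (by simp))

/-- Scale by an element `t` of order `B P` at `P` and take the residue: the kernel lies in $L(A)$
and the target has dimension $\deg P$. -/
theorem finite_and_dim_add_single_le (A : Divisor K F) (P : Place K F)
    (hA : FiniteDimensional K A.riemannRochSpace) :
    FiniteDimensional K (A + Finsupp.single P 1).riemannRochSpace ∧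
      (A + Finsupp.single P 1).dim ≤ A.dim + P.degree := by
  classical
  set B := A + Finsupp.single P 1 with hB
  have hBP : B P = A P + 1 := by simp [hB]
  have hBQ : ∀ Q, Q ≠ P → B Q = A Q := fun Q hQ => by simp [hB, Finsupp.single_eq_of_ne hQ]
  obtain ⟨t, ht⟩ := P.exists_val_eq_exp (-(B P))
  have hmem : ∀ x ∈ B.riemannRochSpace, x * t ∈ P.ring := fun x hx => by
    rw [P.mem_ring_iff, map_mul, ht, WithZero.exp_neg]
    exact mul_inv_le_one_of_le₀ (mem_riemannRochSpace_iff.mp hx P) zero_le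
  let f : B.riemannRochSpace →ₗ[K] P.residueField :=
    { toFun := fun x => IsLocalRing.residue P.ring ⟨x * t, hmem x x.2⟩
      map_add' := fun x y => by
        rw [← map_add]
        exact congrArg _ (Subtype.ext (add_mul _ _ _))
      map_smul' := fun c x => by
        change _ = IsLocalRing.residue P.ring (c • ⟨x * t, hmem x x.2⟩)
        refine congrArg _ (Subtype.ext ?_)
        rw [P.coe_smul]
        exact smul_mul_assoc _ _ _ }
  have hker : (LinearMap.ker f).map B.riemannRochSpace.subtype ≤ A.riemannRochSpace := by
    rintro _ ⟨x, hx, rfl⟩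
    have h0 : P.val (x * t) < 1 := (P.residue_eq_zero_iff _).mp hx
    refine mem_riemannRochSpace_iff.mpr fun Q => ?_
    by_cases hQ : Q = P
    · subst hQ
      rcases eq_or_ne (x : F) 0 with hx0 | hx0
      · simp [hx0]
      rw [map_mul, ht, Q.val_eq_exp_neg_intOrd hx0, ← WithZero.exp_add,
        ← WithZero.exp_zero, WithZero.exp_lt_exp] at h0
      rw [Submodule.subtype_apply, Q.val_eq_exp_neg_intOrd hx0, WithZero.exp_le_exp]
      omega
    · rw [← hBQ Q hQ]
      exact mem_riemannRochSpace_iff.mp x.2 Q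
  have e := (LinearMap.ker f).equivMapOfInjective _ B.riemannRochSpace.subtype_injective
  have hfin1 := Submodule.finiteDimensional_of_le hker
  have hfin2 : FiniteDimensional K (LinearMap.ker f) := e.symm.finiteDimensional
  have hfin3 : FiniteDimensional K (B.riemannRochSpace ⧸ LinearMap.ker f) :=
    f.quotKerEquivRange.symm.finiteDimensional
  have hfin : FiniteDimensional K B.riemannRochSpace :=
    Module.Finite.of_submodule_quotient (LinearMap.ker f)
  refine ⟨hfin, ?_⟩
  have h1 := f.finrank_range_add_finrank_ker
  have h2 := Submodule.finrank_mono hker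
  have h3 := Submodule.finrank_le (LinearMap.range f)
  rw [← e.finrank_eq] at h2
  simp only [dim, Place.degree]
  omega

theorem finite_and_dim_add_le {C : Divisor K F} (hC : 0 ≤ C) (A : Divisor K F)
    (hA : FiniteDimensional K A.riemannRochSpace) :
    FiniteDimensional K (A + C).riemannRochSpace ∧
      ((A + C).dim : ℤ) ≤ A.dim + C.degree := by
  -- Quantifying over the base divisor makes the property additive, so it need only be checked on
  -- single places.
  let S : AddSubmonoid (Divisor K F) :=
    { carrier := {C | ∀ A : Divisor K F, FiniteDimensional K A.riemannRochSpace →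
        FiniteDimensional K (A + C).riemannRochSpace ∧ ((A + C).dim : ℤ) ≤ A.dim + C.degree}
      zero_mem' := fun A hA => by
        rw [add_zero, ← degreeHom_apply, map_zero]
        exact ⟨hA, by omega⟩
      add_mem' := fun {C C'} h h' A hA => by
        have h1 := h A hA
        have h2 := h' _ h1.1
        rw [← add_assoc, degree_add]
        exact ⟨h2.1, by omega⟩ }
  suffices C ∈ S from this A hA
  have hsum : C = ∑ P ∈ C.support, (C P).toNat • Finsupp.single P (1 : ℤ) := by
    conv_lhs => rw [← C.sum_single]
    refine Finset.sum_congr rfl fun P _ => ?_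
    rw [Finsupp.smul_single, nsmul_one, Int.natCast_toNat_eq_self.mpr (hC P)]
  rw [hsum]
  refine S.sum_mem fun P _ => S.nsmul_mem (fun A hA => ?_) _
  have h := finite_and_dim_add_single_le A P hA
  rw [degree_single]
  exact ⟨h.1, by have := h.2; omega⟩

theorem finite_riemannRochSpace (hK : algebraicClosure K F = ⊥) (A : Divisor K F) :
    FiniteDimensional K A.riemannRochSpace := by
  have h := (finite_and_dim_add_le (le_sup_right : 0 ≤ A ⊔ 0) 0
    (finite_riemannRochSpace_zero hK)).1
  rw [zero_add] at h
  exact Submodule.finiteDimensional_of_le (riemannRochSpace_mono (le_sup_left : A ≤ A ⊔ 0))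

theorem dim_le_one_add_degree (hK : algebraicClosure K F = ⊥) {A : Divisor K F} (hA : 0 ≤ A) :
    (A.dim : ℤ) ≤ 1 + A.degree := by
  have h := (finite_and_dim_add_le hA 0 (finite_riemannRochSpace_zero hK)).2
  have h1 := dim_zero_le hK
  rw [zero_add] at h
  omega

/-! ### Degrees of principal divisors -/

variable [Finite K]

/-- The principal divisor of `x` (with the value `0` at `x = 0`). -/
noncomputable def principal (x : F) : Divisor K F :=
  Finsupp.ofSupportFinite (fun P => P.intOrd x) (Place.finite_support_intOrd x)

theorem principal_apply (x : F) (P : Place K F) : principal x P = P.intOrd x := rfl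

theorem mem_riemannRochSpace_iff_neg_principal_le {A : Divisor K F} {x : F} (hx : x ≠ 0) :
    x ∈ A.riemannRochSpace ↔ -principal x ≤ A := by
  rw [mem_riemannRochSpace_iff]
  refine forall_congr' fun P => ?_
  rw [P.val_le_exp_iff hx, Finsupp.neg_apply, principal_apply, neg_le]

/-- The divisor of zeros has degree at most `[F : K(y)]`. -/
theorem degree_principal_sup_zero_le {y : F} (hy : Transcendental K y) :
    (principal y ⊔ 0 : Divisor K F).degree ≤
      Module.finrank (IntermediateField.adjoin K ({y} : Set F)) F := by
  have hy0 : y ≠ 0 := by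
    rintro rfl
    exact hy isAlgebraic_zero
  have hpos : ∀ P : Place K F, P ∈ (principal y ⊔ 0 : Divisor K F).support → 0 < P.intOrd y := by
    intro P hP
    rw [Finsupp.mem_support_iff, Finsupp.sup_apply, principal_apply, Finsupp.zero_apply] at hP
    by_contra! h
    exact hP (sup_eq_right.mpr h)
  refine le_trans (le_of_eq ?_) (Place.sum_intOrd_mul_degree_le
    (P := fun i : (principal y ⊔ 0 : Divisor K F).support => (i : Place K F))
    Subtype.val_injective hy fun P => (P.1.val_lt_one_iff hy0).mpr (hpos P.1 P.2))
  rw [degree, Finsupp.sum, ← Finset.sum_coe_sort]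
  refine Finset.sum_congr rfl fun P _ => ?_
  rw [Finsupp.sup_apply, principal_apply, Finsupp.zero_apply, sup_eq_left.mpr (hpos P.1 P.2).le]

/-- The divisor of poles has degree at least `[F : K(y)]`. -/
theorem le_degree_neg_principal_sup_zero (hK : algebraicClosure K F = ⊥) {y : F}
    (hy : Transcendental K y) :
    (Module.finrank (IntermediateField.adjoin K ({y} : Set F)) F : ℤ) ≤
      (-principal y ⊔ 0 : Divisor K F).degree := by
  have hfin := Place.finite_adjoin_of_transcendental hy
  have hy0 : y ≠ 0 := by
    rintro rfl
    exact hy isAlgebraic_zero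
  set E := IntermediateField.adjoin K ({y} : Set F) with hE
  set N : Divisor K F := -principal y ⊔ 0 with hN
  have hN0 : 0 ≤ N := le_sup_right
  let u := Module.finBasis E F
  -- A bound for the poles of the whole basis: every `u j` lies in $L(C)$.
  let C : Divisor K F := ∑ j, (-principal (u j) ⊔ 0)
  have hC0 : 0 ≤ C := Finset.sum_nonneg fun j _ => le_sup_right
  have huC : ∀ j, u j ∈ C.riemannRochSpace := fun j =>
    (mem_riemannRochSpace_iff_neg_principal_le (u.ne_zero j)).mpr <| le_sup_left.trans <|
      Finset.single_le_sum (f := fun j => (-principal (u j) ⊔ 0 : Divisor K F))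
        (fun j _ => le_sup_right) (Finset.mem_univ j)
  have hyN : y ∈ N.riemannRochSpace :=
    (mem_riemannRochSpace_iff_neg_principal_le hy0).mpr le_sup_left
  have hgen : Transcendental K (IntermediateField.AdjoinSimple.gen K y) := by
    rw [← transcendental_algebraMap_iff (algebraMap E F).injective]
    exact hy
  have key : ∀ r : ℕ, ((r + 1 : ℕ) : ℤ) * Module.finrank E F ≤ 1 + (r * N.degree + C.degree) := by
    intro r
    have hli := linearIndependent_smul ((hgen.linearIndependent_pow).comp
      (Fin.val : Fin (r + 1) → ℕ) Fin.val_injective) u.linearIndependent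
    have hmem : ∀ p : Fin (r + 1) × Fin (Module.finrank E F),
        (IntermediateField.AdjoinSimple.gen K y ^ (p.1 : ℕ)) • u p.2 ∈
          (r • N + C).riemannRochSpace := by
      intro p
      rw [Algebra.smul_def, map_pow]
      refine mul_mem_riemannRochSpace ?_ (huC p.2)
      exact riemannRochSpace_mono (nsmul_le_nsmul_left hN0 (Nat.lt_succ_iff.mp p.1.2))
        (pow_mem_riemannRochSpace hyN _)
    have := finite_riemannRochSpace hK (r • N + C)
    have hli' : LinearIndependent K fun p => (⟨_, hmem p⟩ : (r • N + C).riemannRochSpace) :=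
      LinearIndependent.of_comp (r • N + C).riemannRochSpace.subtype hli
    have h1 := hli'.fintype_card_le_finrank
    have h2 := dim_le_one_add_degree hK (add_nonneg (nsmul_nonneg hN0 r) hC0)
    rw [degree_add, degree_nsmul] at h2
    rw [Fintype.card_prod, Fintype.card_fin, Fintype.card_fin] at h1
    refine le_trans ?_ h2
    exact_mod_cast h1
  by_contra! hlt
  have hCd := degree_nonneg hC0
  -- If $[F:E]\ge\deg N+1$, then `key` yields $\deg N+r\le\deg C$, which fails for $r=1+\deg C$.
  have h := key (1 + C.degree.toNat)
  push_cast at h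
  rw [Int.toNat_of_nonneg hCd] at h
  have hNd := degree_nonneg hN0
  nlinarith

/-- For transcendental `x`, the zero divisor has degree at most $[F:K(x)]$ and the pole divisor at
least that. -/
theorem degree_principal_nonpos (hK : algebraicClosure K F = ⊥) (x : F) :
    (principal x : Divisor K F).degree ≤ 0 := by
  by_cases hx : IsAlgebraic K x
  · have h0 : (principal x : Divisor K F) = 0 :=
      Finsupp.ext fun P => P.intOrd_eq_zero_of_isAlgebraic hx
    rw [h0, ← degreeHom_apply, map_zero]
  have h : (principal x : Divisor K F) = (principal x ⊔ 0) - (-principal x ⊔ 0) := by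
    refine Finsupp.ext fun P => ?_
    simp only [Finsupp.sub_apply, Finsupp.sup_apply, Finsupp.neg_apply, Finsupp.zero_apply]
    omega
  have h1 := degree_principal_sup_zero_le hx
  have h2 := le_degree_neg_principal_sup_zero hK hx
  rw [h, degree_sub]
  omega

/-- A divisor whose Riemann–Roch space is not zero has nonnegative degree. -/
theorem degree_nonneg_of_mem (hK : algebraicClosure K F = ⊥) {A : Divisor K F} {x : F} (hx0 : x ≠ 0)
    (hx : x ∈ A.riemannRochSpace) : 0 ≤ A.degree := by
  have h := degree_mono ((mem_riemannRochSpace_iff_neg_principal_le hx0).mp hx)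
  have h1 := degree_principal_nonpos hK x
  rw [← degreeHom_apply, map_neg, degreeHom_apply] at h
  omega

end Divisor

/-! ### The evaluation map and the code parameters -/

theorem mainTheorem1 {K F : Type*} [Field K] [Finite K] [Field F] [Algebra K F]
    [IsAlgFunctionField K F] (hK : algebraicClosure K F = ⊥)
    {n : ℕ} (P : Fin n → Place K F) (hP : Function.Injective P) (hdeg : ∀ i, (P i).degree = 1)
    (D G : Divisor K F) (hD : D = ∑ i, Finsupp.single (P i) 1)
    (hG : Disjoint G.support D.support) :
    FiniteDimensional K G.riemannRochSpace ∧
    FiniteDimensional K (G - D).riemannRochSpace ∧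
    (Module.finrank K (goppaCode P G) : ℤ) = (G.dim : ℤ) - ((G - D).dim : ℤ) ∧
    (goppaCode P G ≠ ⊥ → ∃ d : ℕ, IsMinDist (goppaCode P G) d ∧ (n : ℤ) - G.degree ≤ (d : ℤ)) := by
  classical
  have hsum : ∀ (s : Finset (Fin n)) (Q : Place K F),
      (∑ i ∈ s, Finsupp.single (P i) (1 : ℤ)) Q = if ∃ i ∈ s, P i = Q then 1 else 0 := by
    intro s Q
    rw [Finsupp.finsetSum_apply]
    split_ifs with h
    · obtain ⟨i, hi, rfl⟩ := h
      rw [Finset.sum_eq_single_of_mem i hi fun j _ hj =>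
        Finsupp.single_eq_of_ne fun h => hj (hP h.symm), Finsupp.single_eq_same]
    · push Not at h
      exact Finset.sum_eq_zero fun i hi => Finsupp.single_eq_of_ne (h i hi).symm
  have hGP : ∀ i, G (P i) = 0 := fun i => by
    have h : P i ∈ D.support := by
      rw [Finsupp.mem_support_iff, hD, hsum, if_pos ⟨i, Finset.mem_univ i, rfl⟩]
      exact one_ne_zero
    exact Finsupp.notMem_support_iff.mp (Finset.disjoint_right.mp hG h)
  have hfin := Divisor.finite_riemannRochSpace hK G
  have hring : ∀ x ∈ G.riemannRochSpace, ∀ i, x ∈ (P i).ring := fun x hx i => by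
    have h := Divisor.mem_riemannRochSpace_iff.mp hx (P i)
    rwa [hGP, WithZero.exp_zero, ← Place.mem_ring_iff] at h
  -- Functions in `L(G)` that vanish at the places in `s`.
  have hvanish : ∀ (s : Finset (Fin n)), ∀ x ∈ G.riemannRochSpace,
      x ∈ (G - ∑ i ∈ s, Finsupp.single (P i) 1).riemannRochSpace ↔
        ∀ i ∈ s, (P i).val x < 1 := by
    intro s x hx
    rcases eq_or_ne x 0 with rfl | hx0
    · simp
    rw [Divisor.mem_riemannRochSpace_iff] at hx ⊢
    constructor
    · intro h i hi
      have h1 := h (P i)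
      rw [Finsupp.sub_apply, hGP, hsum, if_pos ⟨i, hi, rfl⟩] at h1
      refine h1.trans_lt ?_
      rw [← WithZero.exp_zero, WithZero.exp_lt_exp]
      omega
    · intro h Q
      rw [Finsupp.sub_apply, hsum]
      split_ifs with hQ
      · obtain ⟨i, hi, rfl⟩ := hQ
        have h1 := ((P i).val_lt_one_iff hx0).mp (h i hi)
        rw [Place.val_le_exp_iff _ hx0, hGP]
        omega
      · rw [sub_zero]
        exact hx Q
  -- Degree one makes the injection of $K$ into the residue field bijective.
  let ρ : ∀ i, K ≃ₗ[K] (P i).residueField := fun i =>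
    LinearEquiv.ofBijective (Algebra.linearMap K (P i).residueField)
      ⟨(algebraMap K (P i).residueField).injective,
        (LinearMap.injective_iff_surjective_of_finrank_eq_finrank
          ((Module.finrank_self K).trans (hdeg i).symm)).mp
          (algebraMap K (P i).residueField).injective⟩
  have hρ : ∀ i a, ρ i a = algebraMap K (P i).residueField a := fun i a => rfl
  let ev : G.riemannRochSpace →ₗ[K] (Fin n → K) := LinearMap.pi fun i =>
    (ρ i).symm.toLinearMap ∘ₗ
      { toFun := fun x => IsLocalRing.residue (P i).ring ⟨x, hring x x.2 i⟩
        map_add' := fun x y => map_add (IsLocalRing.residue (P i).ring)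
          ⟨x, hring x x.2 i⟩ ⟨y, hring y y.2 i⟩
        map_smul' := fun c x => by
          change _ = IsLocalRing.residue (P i).ring (c • ⟨x, hring x x.2 i⟩)
          exact congrArg _ (Subtype.ext ((P i).coe_smul c ⟨x, hring x x.2 i⟩).symm) }
  have hev : ∀ x i (a : K), ev x i = a ↔ (P i).value x =
      ((algebraMap K (P i).residueField a : (P i).residueField) : WithTop _) := by
    intro x i a
    rw [Place.value_eq_coe_iff, ← hρ]
    change (ρ i).symm (IsLocalRing.residue (P i).ring ⟨x, hring x x.2 i⟩) = a ↔ _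
    rw [LinearEquiv.symm_apply_eq]
    exact ⟨fun h => ⟨_, h⟩, fun ⟨_, h⟩ => h⟩
  have hev0 : ∀ x i, ev x i = 0 ↔ (P i).val x < 1 := by
    intro x i
    change (ρ i).symm (IsLocalRing.residue (P i).ring ⟨x, hring x x.2 i⟩) = 0 ↔ _
    rw [LinearEquiv.map_eq_zero_iff, Place.residue_eq_zero_iff]
  have hrange : LinearMap.range ev = goppaCode P G := by
    ext c
    constructor
    · rintro ⟨x, rfl⟩
      exact ⟨x, x.2, fun i => (hev x i _).mp rfl⟩
    · rintro ⟨x, hx, h⟩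
      exact ⟨⟨x, hx⟩, funext fun i => (hev ⟨x, hx⟩ i _).mpr (h i)⟩
  have hker : (LinearMap.ker ev).map G.riemannRochSpace.subtype = (G - D).riemannRochSpace := by
    have hle : (G - D).riemannRochSpace ≤ G.riemannRochSpace := by
      refine Divisor.riemannRochSpace_mono (sub_le_self G ?_)
      rw [hD]
      exact Finset.sum_nonneg fun i _ => Finsupp.single_nonneg.mpr zero_le_one
    ext x
    rw [Submodule.mem_map]
    constructor
    · rintro ⟨x, hx, rfl⟩
      rw [hD]
      exact (hvanish _ _ x.2).mpr fun i _ => (hev0 x i).mp (congrFun hx i)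
    · intro hx
      have hxG := hle hx
      rw [hD] at hx
      exact ⟨⟨x, hxG⟩, funext fun i =>
        (hev0 ⟨x, hxG⟩ i).mpr ((hvanish _ x hxG).mp hx i (Finset.mem_univ i)), rfl⟩
  refine ⟨hfin, Divisor.finite_riemannRochSpace hK _, ?_, fun hne => ?_⟩
  · have e := (LinearMap.ker ev).equivMapOfInjective _ G.riemannRochSpace.subtype_injective
    have h := ev.finrank_range_add_finrank_ker
    rw [e.finrank_eq, hker, hrange] at h
    rw [Divisor.dim, Divisor.dim, ← h]
    push_cast
    ring
  · obtain ⟨c, hc, hc0⟩ := Submodule.exists_mem_ne_zero_of_ne_bot hne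
    -- A nonzero word and 0 are two distinct codewords, so the `sInf` below is attained rather than
    -- the default 0 of an empty set.
    have hnonempty : {m : ℕ | ∃ x ∈ goppaCode P G, ∃ y ∈ goppaCode P G,
        x ≠ y ∧ hammingDist x y = m}.Nonempty := ⟨_, c, hc, 0, zero_mem _, hc0, rfl⟩
    refine ⟨sInf _, ⟨Nat.sInf_mem hnonempty, fun m hm => Nat.sInf_le hm⟩, ?_⟩
    obtain ⟨a, ha, b, hb, hab, hm⟩ := Nat.sInf_mem hnonempty
    rw [← hm]
    have hmem := sub_mem ha hb
    rw [← hrange] at hmem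
    obtain ⟨x, hx⟩ := hmem
    have hx0 : (x : F) ≠ 0 := fun h => by
      have h0 : x = 0 := Subtype.ext h
      rw [h0, map_zero] at hx
      exact hab (sub_eq_zero.mp hx.symm)
    -- The agreement set of a closest pair: `x` vanishes at these places, so `s.card` is at most the
    -- degree of `G`.
    let s : Finset (Fin n) := {i | a i = b i}
    have hxs := (hvanish s x x.2).mpr fun i hi => (hev0 x i).mp (by
      rw [hx, Pi.sub_apply, sub_eq_zero]
      exact (Finset.mem_filter.mp hi).2)
    have hd := Divisor.degree_nonneg_of_mem hK hx0 hxs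
    have hsd : (∑ i ∈ s, Finsupp.single (P i) 1 : Divisor K F).degree = s.card := by
      rw [← Divisor.degreeHom_apply, map_sum]
      simp [Divisor.degreeHom_apply, Divisor.degree_single, hdeg]
    rw [Divisor.degree_sub, hsd] at hd
    have hcard := Finset.card_filter_add_card_filter_not (s := Finset.univ) fun i => a i = b i
    rw [Finset.card_univ, Fintype.card_fin] at hcard
    have hham : hammingDist a b = (Finset.univ.filter fun i => ¬ a i = b i).card := rfl
    rw [hham]
    change 0 ≤ G.degree - ((Finset.univ.filter fun i => a i = b i).card : ℤ) at hd
    omega
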